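/- Let $k$ be a field of characteristic different from $2$ and $3$. Let $(A,\mathfrak m)$ be a local Artinian Gorenstein $k$-algebra (Gorenstein: the socle $(0:\mathfrak m)$ is one-dimensional over $A/\mathfrak m$) such that the natural map $k\to A/\mathfrak m$ is an isomorphism; the last condition is automatic if $k$ is algebraically closed and $\dim_k A<\infty$. Let $H_A(i)=\dim_k \mathfrak m^i/\mathfrak m^{i+1}$ be the Hilbert function of $A$, let $d=\max\{i : \mathfrak m^i\neq 0\}$ be its socle degree, and let $\operatorname{gr}A=\bigoplus_{i\ge 0}\mathfrak m^i/\mathfrak m^{i+1}$ be its associated graded algebra. With $n=H_A(1)$, the algebra $A$ is called compressed if $$H_A(i)=\min\left(\binom{i+n-1}{i},\binom{d-i+n-1}{d-i}\right)\quad\text{for all } 0\le i\le d$$ (with the convention $\binom{-1}{0}=1$). 1. If $A$ is compressed and $d\le 4$, then $A$ is canonically graded, i.e. $A\simeq\operatorname{gr}A$ as $k$-algebras. 2. If $H_A=(1,n,n,1)$ for some $n$, then $A$ is compressed of socle degree $3$; if $H_A=\left(1,n,\binom{n+1}{2},n,1\right)$ for some $n$, then $A$ is compressed of socle degree $4$.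 In particular, in both cases $A\simeq\operatorname{gr}A$ as $k$-algebras. -/

import Mathlib

open scoped DirectSum

noncomputable section

namespace AssocGr

universe u v

section Construction

variable {A : Type v} [CommRing A] (I : Ideal A)

/-- The `i`-th graded piece `I ^ i / I ^ (i + 1)`. -/
abbrev Piece (i : ℕ) : Type v :=
  ↥(I ^ i) ⧸ Submodule.comap (I ^ i).subtype (I ^ (i + 1))

/-- The class in `I ^ i / I ^ (i + 1)` of an element of `I ^ i`. -/
def cls (i : ℕ) (a : A) (ha : a ∈ I ^ i) : Piece I i :=
  Submodule.Quotient.mk ⟨a, ha⟩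

theorem cls_surj {i : ℕ} (x : Piece I i) : ∃ (a : A) (ha : a ∈ I ^ i), x = cls I i a ha := by
  obtain ⟨⟨a, ha⟩, rfl⟩ := Submodule.Quotient.mk_surjective _ x
  exact ⟨a, ha, rfl⟩

theorem cls_eq_iff {i : ℕ} {a b : A} (ha : a ∈ I ^ i) (hb : b ∈ I ^ i) :
    cls I i a ha = cls I i b hb ↔ a - b ∈ I ^ (i + 1) := by
  unfold cls
  rw [Submodule.Quotient.eq]
  rfl

theorem cls_add {i : ℕ} {a b : A} (ha : a ∈ I ^ i) (hb : b ∈ I ^ i) :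
    cls I i a ha + cls I i b hb = cls I i (a + b) (add_mem ha hb) := rfl

theorem mul_mem_pow {i j : ℕ} {a b : A} (ha : a ∈ I ^ i) (hb : b ∈ I ^ j) :
    a * b ∈ I ^ (i + j) := by
  rw [pow_add]
  exact Ideal.mul_mem_mul ha hb

/-- The multiplication `I ^ i / I ^ (i + 1) × I ^ j / I ^ (j + 1) → I ^ (i + j) / I ^ (i + j + 1)`
induced by the multiplication of `A`. -/
def pieceMul {i j : ℕ} (x : Piece I i) (y : Piece I j) : Piece I (i + j) :=
  Quotient.liftOn₂' x y
    (fun a b => cls I (i + j) ((a : A) * (b : A)) (mul_mem_pow I a.2 b.2))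
    (by
      rintro ⟨a, ha⟩ ⟨b, hb⟩ ⟨a', ha'⟩ ⟨b', hb'⟩ h₁ h₂
      rw [Submodule.quotientRel_def] at h₁ h₂
      have e₁ : a - a' ∈ I ^ (i + 1) := h₁
      have e₂ : b - b' ∈ I ^ (j + 1) := h₂
      refine (cls_eq_iff I _ _).2 ?_
      have e : a * b - a' * b' = (a - a') * b + a' * (b - b') := by ring
      change a * b - a' * b' ∈ _
      rw [e]
      refine add_mem ?_ ?_
      · have := mul_mem_pow I e₁ hb
        rwa [show i + 1 + j = i + j + 1 by omega] at this
      · have := mul_mem_pow I ha' e₂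
        rwa [← add_assoc] at this)

theorem pieceMul_cls {i j : ℕ} {a b : A} (ha : a ∈ I ^ i) (hb : b ∈ I ^ j) :
    pieceMul I (cls I i a ha) (cls I j b hb) = cls I (i + j) (a * b) (mul_mem_pow I ha hb) :=
  rfl

theorem mem_pow_zero (a : A) : a ∈ I ^ 0 := by simp

theorem mk_cls_eq {i j : ℕ} {a b : A} (ha : a ∈ I ^ i) (hb : b ∈ I ^ j) (hij : i = j)
    (hab : a = b) :
    (GradedMonoid.mk i (cls I i a ha) : GradedMonoid (Piece I)) =
      GradedMonoid.mk j (cls I j b hb) := by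
  subst hij; subst hab; rfl

instance gMul : GradedMonoid.GMul (Piece I) where
  mul x y := pieceMul I x y

instance gOne : GradedMonoid.GOne (Piece I) where
  one := cls I 0 1 (mem_pow_zero I 1)

instance gCommRing : DirectSum.GCommRing (Piece I) where
  mul_zero {i j} x := by
    obtain ⟨a, ha, rfl⟩ := cls_surj I x
    exact (cls_eq_iff I (mul_mem_pow I ha (zero_mem (I ^ j))) (zero_mem _)).2 (by simp)
  zero_mul {i j} y := by
    obtain ⟨b, hb, rfl⟩ := cls_surj I y
    exact (cls_eq_iff I (mul_mem_pow I (zero_mem (I ^ i)) hb) (zero_mem _)).2 (by simp)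
  mul_add {i j} x y z := by
    obtain ⟨a, ha, rfl⟩ := cls_surj I x
    obtain ⟨b, hb, rfl⟩ := cls_surj I y
    obtain ⟨c, hc, rfl⟩ := cls_surj I z
    exact (cls_eq_iff I (mul_mem_pow I ha (add_mem hb hc))
      (add_mem (mul_mem_pow I ha hb) (mul_mem_pow I ha hc))).2 (by simp [mul_add])
  add_mul {i j} x y z := by
    obtain ⟨a, ha, rfl⟩ := cls_surj I x
    obtain ⟨b, hb, rfl⟩ := cls_surj I y
    obtain ⟨c, hc, rfl⟩ := cls_surj I z
    exact (cls_eq_iff I (mul_mem_pow I (add_mem ha hb) hc)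
      (add_mem (mul_mem_pow I ha hc) (mul_mem_pow I hb hc))).2 (by simp [add_mul])
  one_mul := by
    rintro ⟨i, x⟩
    obtain ⟨a, ha, rfl⟩ := cls_surj I x
    exact mk_cls_eq I _ _ (zero_add i) (one_mul a)
  mul_one := by
    rintro ⟨i, x⟩
    obtain ⟨a, ha, rfl⟩ := cls_surj I x
    exact mk_cls_eq I _ _ (add_zero i) (mul_one a)
  mul_assoc := by
    rintro ⟨i, x⟩ ⟨j, y⟩ ⟨l, z⟩
    obtain ⟨a, ha, rfl⟩ := cls_surj I x
    obtain ⟨b, hb, rfl⟩ := cls_surj I y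
    obtain ⟨c, hc, rfl⟩ := cls_surj I z
    exact mk_cls_eq I _ _ (add_assoc i j l) (mul_assoc a b c)
  mul_comm := by
    rintro ⟨i, x⟩ ⟨j, y⟩
    obtain ⟨a, ha, rfl⟩ := cls_surj I x
    obtain ⟨b, hb, rfl⟩ := cls_surj I y
    exact mk_cls_eq I _ _ (add_comm i j) (mul_comm a b)
  natCast n := cls I 0 (n : A) (mem_pow_zero I _)
  natCast_zero := (cls_eq_iff I _ (zero_mem _)).2 (by simp)
  natCast_succ n := (cls_eq_iff I _ (add_mem (mem_pow_zero I _) (mem_pow_zero I _))).2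
    (by simp)
  intCast n := cls I 0 (n : A) (mem_pow_zero I _)
  intCast_ofNat n := (cls_eq_iff I _ _).2 (by simp)
  intCast_negSucc_ofNat n := (cls_eq_iff I _ (neg_mem (mem_pow_zero I _))).2 (by simp)

instance gAlgebra (k : Type u) [CommRing k] [Algebra k A] : DirectSum.GAlgebra k (Piece I) where
  toFun :=
    { toFun := fun c => cls I 0 (algebraMap k A c) (mem_pow_zero I _)
      map_zero' := (cls_eq_iff I _ (zero_mem _)).2 (by simp)
      map_add' := fun c c' =>
        (cls_eq_iff I _ (add_mem (mem_pow_zero I _) (mem_pow_zero I _))).2 (by simp) }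
  map_one := (cls_eq_iff I _ _).2 (by simp)
  map_mul c c' := mk_cls_eq I (mem_pow_zero I _)
    (mul_mem_pow I (mem_pow_zero I _) (mem_pow_zero I _)) rfl (map_mul _ c c')
  commutes c := by
    rintro ⟨i, x⟩
    obtain ⟨a, ha, rfl⟩ := cls_surj I x
    exact mk_cls_eq I (mul_mem_pow I (mem_pow_zero I _) ha)
      (mul_mem_pow I ha (mem_pow_zero I _)) (add_comm 0 i) (mul_comm _ a)
  smul_def c := by
    rintro ⟨i, x⟩
    obtain ⟨a, ha, rfl⟩ := cls_surj I x
    have h : c • a ∈ I ^ i := by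
      rw [Algebra.smul_def]
      exact Ideal.mul_mem_left _ _ ha
    exact mk_cls_eq I h (mul_mem_pow I (mem_pow_zero I _) ha) (zero_add i).symm
      (Algebra.smul_def c a)

end Construction

section LocalAlgebras

variable (k : Type u) [Field k] (A : Type v) [CommRing A] [IsLocalRing A] [Algebra k A]

open IsLocalRing

/-- The associated graded ring `gr A = ⨁ i, 𝔪 ^ i / 𝔪 ^ (i + 1)` of a local ring. -/
abbrev Gr : Type v := ⨁ i, Piece (maximalIdeal A) i

/-- The Hilbert function `H_A i = dim_k (𝔪 ^ i / 𝔪 ^ (i + 1))`. -/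
def hilbertFunction (i : ℕ) : ℕ := Module.finrank k (Piece (maximalIdeal A) i)

/-- The socle of a local ring: the elements killed by the maximal ideal. -/
def socle : Ideal A := Module.annihilator A (maximalIdeal A)

/-- An Artinian local ring is Gorenstein if its socle is a simple module, i.e. one-dimensional
over the residue field. -/
def IsArtinGorenstein : Prop := IsArtinianRing A ∧ IsSimpleModule A (socle A)

/-- `d` is the socle degree of `A`: the largest `i` with `𝔪 ^ i ≠ 0`. -/
def IsSocleDegree (d : ℕ) : Prop := IsGreatest {i : ℕ | maximalIdeal A ^ i ≠ ⊥} d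

/-- `A` is compressed of socle degree `d`: with `n = H_A 1` the embedding dimension,
`H_A i = min (dim S_i) (dim S_{d-i})` for `0 ≤ i ≤ d`, where `S` is a power series ring in `n`
variables, so that `dim S_i = binom (i + n - 1) i`, which is `Nat.multichoose n i`
(in particular `dim S_0 = 1` also for `n = 0`). -/
def IsCompressed (d : ℕ) : Prop :=
  IsSocleDegree A d ∧
    ∀ i ≤ d, hilbertFunction k A i =
      min (Nat.multichoose (hilbertFunction k A 1) i)
        (Nat.multichoose (hilbertFunction k A 1) (d - i))

/-- `A` is canonically graded: isomorphic, as a `k`-algebra, to its associated graded algebra. -/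
def IsCanonicallyGraded : Prop := Nonempty (A ≃ₐ[k] Gr A)

end LocalAlgebras

end AssocGr

end

/-! Present `A` as a quotient of a polynomial ring `S` by choosing coordinates `x`, and let `φ` be a
functional on `A` whose kernel contains no nonzero ideal; the Gorenstein condition supplies one. The
relations among the `x i` are then determined by the values of `φ` on forms. If they form a
homogeneous ideal, `A` and `gr A` are the same quotient of `S`.

Write `d = e + 1`. By `isCanonicallyGraded_of_functional`, homogeneity follows once `φ` vanishes on
forms of degree `e` and no nonzero form of degree below `e` has a value of higher order. For `d = 2,
3, 4`, compressedness gives the second condition through dimension counts.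

For the first, replace `x i` by `x i + c i` with `c i` in `𝔪 ^ 2`. On a form `s` of degree `e` the
Taylor expansion stops after the linear term, because `𝔪 ^ (e + 2) = 0`. If `φ (c i * t) = -e⁻¹ * φ
(x i * t)` for all forms `t` of degree `e - 1`, Euler's identity `∑ X i * ∂ᵢ s = e * s` makes the
new value zero. Such `c i` exist by `representsForms`: pairing by `φ` embeds `𝔪 ^ (d - i) / 𝔪 ^ (d -
i + 1)` into the dual of `S_i`, and the dimensions agree. Dividing by `e = 2, 3` is where the
characteristic enters. -/

noncomputable section

namespace AssocGr

open MvPolynomial IsLocalRing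

/-! ### Forms: induction and dimension count. -/

section Polynomials

variable {k : Type*} [Field k] {σ : Type*}

/-- Induction principle for homogeneous polynomials: a graded predicate which is additive in each
degree and multiplicative holds for all of them once it holds for constants and variables. -/
theorem isHomogeneous_induction {P : ℕ → MvPolynomial σ k → Prop}
    (h_zero : ∀ i, P i 0) (h_add : ∀ i s t, P i s → P i t → P i (s + t))
    (h_const : ∀ c, P 0 (C c)) (h_var : ∀ j, P 1 (X j))
    (h_mul : ∀ i j s t, P i s → P j t → P (i + j) (s * t))
    {i : ℕ} {s : MvPolynomial σ k} (hs : s.IsHomogeneous i) : P i s := by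
  classical
  have hmon : ∀ e : σ →₀ ℕ, ∀ c : k, P e.degree (monomial e c) := by
    intro e
    induction e using Finsupp.induction_linear with
    | zero => intro c; simpa using h_const c
    | add f g hf hg =>
      intro c
      have := h_mul _ _ _ _ (hf c) (hg 1)
      rwa [monomial_mul, mul_one, ← map_add] at this
    | single j m =>
      intro c
      induction m generalizing c with
      | zero => simpa using h_const c
      | succ m ih =>
        have := h_mul _ _ _ _ (ih c) (h_var j)
        rw [X, monomial_mul, mul_one, ← Finsupp.single_add] at this
        simpa using this
  rw [s.as_sum]
  have key : ∀ t : Finset (σ →₀ ℕ), t ⊆ s.support →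
      P i (∑ e ∈ t, monomial e (coeff e s)) := by
    intro t
    induction t using Finset.induction_on with
    | empty => intro _; simpa using h_zero i
    | insert e t he ih =>
      intro h
      rw [Finset.sum_insert he]
      refine h_add _ _ _ ?_ (ih fun x hx => h (Finset.mem_insert_of_mem hx))
      have hd : e.degree = i := by
        by_contra hne
        exact mem_support_iff.1 (h (Finset.mem_insert_self e t)) (hs.coeff_eq_zero hne)
      simpa [hd] using hmon e (coeff e s)
  exact key _ subset_rfl

instance (i : ℕ) [Finite σ] : Module.Finite k (homogeneousSubmodule σ k i) :=
  Module.Finite.iff_fg.2 (homogeneousSubmodule_fg σ k i)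

theorem finrank_homogeneousSubmodule [Fintype σ] (i : ℕ) :
    Module.finrank k (homogeneousSubmodule σ k i) = (Fintype.card σ).multichoose i := by
  classical
  rw [homogeneousSubmodule_eq_finsupp_supported]
  change Module.finrank k (restrictSupport k {d : σ →₀ ℕ | d.degree = i}) = _
  rw [Module.finrank_eq_nat_card_basis (basisRestrictSupport k {d : σ →₀ ℕ | d.degree = i}),
    ← Sym.card_sym_eq_multichoose, ← Nat.card_eq_fintype_card]
  exact Nat.card_congr ((Sym.equivNatSum σ i).symm)

end Polynomials

section Powers

variable {k : Type*} [Field k] {A : Type*} [CommRing A] [Algebra k A] {σ : Type*}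

theorem smul_mem_ideal {I : Ideal A} (c : k) {a : A} (ha : a ∈ I) : c • a ∈ I := by
  rw [Algebra.smul_def]
  exact I.mul_mem_left _ ha

theorem mem_of_le {i j : ℕ} (h : i ≤ j) {I : Ideal A} {a : A} (ha : a ∈ I ^ j) : a ∈ I ^ i :=
  Ideal.pow_le_pow_right h ha

theorem aeval_mem_pow {I : Ideal A} {x : σ → A} (hx : ∀ i, x i ∈ I) {i : ℕ}
    {s : MvPolynomial σ k} (hs : s.IsHomogeneous i) : aeval x s ∈ I ^ i := by
  refine isHomogeneous_induction (P := fun i s => aeval x s ∈ I ^ i) ?_ ?_ ?_ ?_ ?_ hs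
  · simp
  · intro i s t h₁ h₂
    rw [map_add]
    exact add_mem h₁ h₂
  · simp
  · intro j
    simpa using hx j
  · intro i j s t h₁ h₂
    rw [map_mul]
    exact mul_mem_pow I h₁ h₂

end Powers

/-! ### Coordinates on a local algebra and polynomial expansions. -/

section Coordinates

variable {k : Type*} [Field k] {A : Type*} [CommRing A] [IsLocalRing A] [Algebra k A]
  {σ : Type*} [Fintype σ]

variable (k) in
/-- A finite family in the maximal ideal of a local `k`-algebra with residue field `k`, spanning
the cotangent space. -/
structure IsCoordinates (x : σ → A) : Prop where
  residue : ∀ a : A, ∃ c : k, a - algebraMap k A c ∈ maximalIdeal A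
  mem : ∀ i, x i ∈ maximalIdeal A
  span : ∀ a ∈ maximalIdeal A, ∃ c : σ → k, a - ∑ i, c i • x i ∈ maximalIdeal A ^ 2

namespace IsCoordinates

variable {x : σ → A}

theorem add (hx : IsCoordinates k x) {c : σ → A} (hc : ∀ i, c i ∈ maximalIdeal A ^ 2) :
    IsCoordinates k (fun i => x i + c i) where
  residue := hx.residue
  mem i := add_mem (hx.mem i) (Ideal.pow_le_self two_ne_zero (hc i))
  span a ha := by
    obtain ⟨r, hr⟩ := hx.span a ha
    refine ⟨r, ?_⟩
    have : a - ∑ i, r i • (x i + c i) = (a - ∑ i, r i • x i) - ∑ i, r i • c i := by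
      simp only [smul_add, Finset.sum_add_distrib]
      ring
    rw [this]
    exact sub_mem hr (sum_mem fun i _ => smul_mem_ideal _ (hc i))

theorem aeval_mem (hx : IsCoordinates k x) {i : ℕ} {s : MvPolynomial σ k} (hs : s.IsHomogeneous i) :
    aeval x s ∈ maximalIdeal A ^ i :=
  aeval_mem_pow hx.mem hs

theorem exists_homogeneous (hx : IsCoordinates k x) (i : ℕ) : ∀ a ∈ maximalIdeal A ^ i,
    ∃ s : MvPolynomial σ k, s.IsHomogeneous i ∧ a - aeval x s ∈ maximalIdeal A ^ (i + 1) := by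
  induction i with
  | zero =>
    intro a _
    obtain ⟨c, hc⟩ := hx.residue a
    exact ⟨C c, isHomogeneous_C _ _, by simpa using hc⟩
  | succ i ih =>
    intro a ha
    rw [pow_succ] at ha
    refine Submodule.mul_induction_on ha ?_ ?_
    · intro b hb c hc
      obtain ⟨s, hs, hs'⟩ := ih b hb
      obtain ⟨r, hr⟩ := hx.span c hc
      have ht : (∑ j, r j • X j : MvPolynomial σ k).IsHomogeneous 1 :=
        IsHomogeneous.sum _ _ _ fun j _ => by
          rw [smul_eq_C_mul]
          exact isHomogeneous_C_mul_X _ _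
      refine ⟨s * ∑ j, r j • X j, hs.mul ht, ?_⟩
      have e : b * c - aeval x (s * ∑ j, r j • X j) =
          (b - aeval x s) * c + aeval x s * (c - ∑ j, r j • x j) := by
        simp only [map_mul, map_sum, map_smul, aeval_X]
        ring
      rw [e]
      refine add_mem ?_ ?_
      · have := mul_mem_pow (maximalIdeal A) hs' (show c ∈ maximalIdeal A ^ 1 by simpa using hc)
        exact this
      · exact mul_mem_pow (i := i) (j := 2) (maximalIdeal A) (hx.aeval_mem hs) hr
    · intro b c ⟨s, hs, hs'⟩ ⟨t, ht, ht'⟩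
      refine ⟨s + t, hs.add ht, ?_⟩
      rw [map_add, add_sub_add_comm]
      exact add_mem hs' ht'

/-- Successive approximation: subtract a form matching the leading term and repeat one order higher,
until `𝔪 ^ N = 0` ends the process. -/
theorem exists_aeval_eq (hx : IsCoordinates k x)
    {N : ℕ} (hN : maximalIdeal A ^ N = ⊥) (i : ℕ) {a : A}
    (ha : a ∈ maximalIdeal A ^ i) :
    ∃ s : MvPolynomial σ k, aeval x s = a ∧ ∀ j < i, homogeneousComponent j s = 0 := by
  by_cases h : N ≤ i
  · refine ⟨0, ?_, by simp⟩
    have := mem_of_le h ha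
    rw [hN, Ideal.mem_bot] at this
    simp [this]
  · obtain ⟨s, hs, hs'⟩ := hx.exists_homogeneous i a ha
    obtain ⟨t, ht, ht'⟩ := exists_aeval_eq hx hN (i + 1) hs'
    refine ⟨s + t, by simp [ht], fun j hj => ?_⟩
    rw [map_add, ht' j (by omega), homogeneousComponent_of_mem (n := i) hs, if_neg (by omega),
      add_zero]
  termination_by N - i

theorem aeval_surjective (hx : IsCoordinates k x) {N : ℕ} (hN : maximalIdeal A ^ N = ⊥) :
    Function.Surjective (aeval x : MvPolynomial σ k →ₐ[k] A) := fun a => by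
  obtain ⟨s, hs, -⟩ := hx.exists_aeval_eq hN 0 (a := a) (by simp)
  exact ⟨s, hs⟩

end IsCoordinates

end Coordinates

/-! ### The polynomial ring mapping onto the associated graded ring. -/

section GradedMap

variable {k : Type*} [Field k] {A : Type*} [CommRing A] [IsLocalRing A] [Algebra k A]
  {σ : Type*}

variable (k) in
/-- The homomorphism from the polynomial ring to the associated graded ring which sends each
variable to the class of the given element of the maximal ideal in degree one. -/
def toGr (x : σ → A) (hx : ∀ i, x i ∈ maximalIdeal A) : MvPolynomial σ k →ₐ[k] Gr A :=
  aeval fun i => DirectSum.of (Piece (maximalIdeal A)) 1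
    (cls (maximalIdeal A) 1 (x i) (by simpa using hx i))

theorem toGr_of_isHomogeneous (x : σ → A) (hx : ∀ i, x i ∈ maximalIdeal A) {i : ℕ}
    {s : MvPolynomial σ k} (hs : s.IsHomogeneous i) :
    toGr k x hx s = DirectSum.of (Piece (maximalIdeal A)) i
      (cls (maximalIdeal A) i (aeval x s) (aeval_mem_pow hx hs)) := by
  -- The membership is bundled into the predicate, since the induction needs a predicate that makes
  -- sense for arbitrary polynomials.
  suffices h : ∃ h : aeval x s ∈ maximalIdeal A ^ i, toGr k x hx s =
      DirectSum.of (Piece (maximalIdeal A)) i (cls (maximalIdeal A) i (aeval x s) h) from h.2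
  refine isHomogeneous_induction (P := fun i s => ∃ h : aeval x s ∈ maximalIdeal A ^ i,
    toGr k x hx s = DirectSum.of (Piece (maximalIdeal A)) i
      (cls (maximalIdeal A) i (aeval x s) h)) ?_ ?_ ?_ ?_ ?_ hs
  · intro i
    refine ⟨by simp, ?_⟩
    have : cls (maximalIdeal A) i (aeval x (0 : MvPolynomial σ k)) (by simp) = 0 :=
      (cls_eq_iff _ _ (zero_mem _)).2 (by simp)
    rw [this, map_zero, map_zero]
  · rintro i s t ⟨h₁, e₁⟩ ⟨h₂, e₂⟩
    refine ⟨by rw [map_add]; exact add_mem h₁ h₂, ?_⟩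
    rw [map_add, e₁, e₂, ← map_add, cls_add]
    congr 1
    exact (cls_eq_iff _ _ _).2 (by simp)
  · intro c
    refine ⟨by simp, ?_⟩
    rw [algHom_C, DirectSum.algebraMap_apply]
    exact congrArg (DirectSum.of (Piece (maximalIdeal A)) 0) ((cls_eq_iff _ _ _).2 (by simp))
  · intro j
    refine ⟨by simpa using hx j, ?_⟩
    rw [toGr, aeval_X]
    congr 1
    exact (cls_eq_iff _ _ _).2 (by simp)
  · rintro i j s t ⟨h₁, e₁⟩ ⟨h₂, e₂⟩
    refine ⟨by rw [map_mul]; exact mul_mem_pow _ h₁ h₂, ?_⟩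
    rw [map_mul, e₁, e₂, DirectSum.of_mul_of]
    congr 1
    exact (cls_eq_iff _ (mul_mem_pow _ h₁ h₂) _).2 (by simp)

theorem toGr_apply (x : σ → A) (hx : ∀ i, x i ∈ maximalIdeal A) (s : MvPolynomial σ k) (i : ℕ) :
    toGr k x hx s i = cls (maximalIdeal A) i (aeval x (homogeneousComponent i s))
      (aeval_mem_pow hx (homogeneousComponent_isHomogeneous i s)) := by
  conv_lhs => rw [← sum_homogeneousComponent s]
  rw [map_sum, DFinsupp.finsetSum_apply]
  simp_rw [toGr_of_isHomogeneous x hx (homogeneousComponent_isHomogeneous _ s)]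
  by_cases h : i ∈ Finset.range (s.totalDegree + 1)
  · rw [Finset.sum_eq_single_of_mem i h]
    · exact DirectSum.of_eq_same _ _
    · intro j _ hj
      exact DirectSum.of_eq_of_ne _ _ _ hj.symm
  · rw [Finset.sum_eq_zero]
    · symm
      refine (cls_eq_iff _ _ (zero_mem _)).2 ?_
      rw [homogeneousComponent_eq_zero _ _ (by simpa using h)]
      simp
    · intro j hj
      refine DirectSum.of_eq_of_ne _ _ _ ?_
      rintro rfl
      exact h hj

end GradedMap

/-! ### Homogeneous relations give a canonical grading. -/

section CanonicalGrading

variable {k : Type*} [Field k] {A : Type*} [CommRing A] [IsLocalRing A] [Algebra k A]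
  {σ : Type*} [Fintype σ]

/-- If the relations among some coordinates form a homogeneous ideal, then the algebra is
canonically graded. -/
theorem IsCoordinates.isCanonicallyGraded {x : σ → A} (hx : IsCoordinates k x) {N : ℕ}
    (hN : maximalIdeal A ^ N = ⊥)
    (hker : ∀ s : MvPolynomial σ k, aeval x s = 0 → ∀ i, aeval x (homogeneousComponent i s) = 0) :
    IsCanonicallyGraded k A := by
  have hsurj := hx.aeval_surjective hN
  have hsurj' : Function.Surjective (toGr k x hx.mem) := by
    intro y
    induction y using DirectSum.induction_on with
    | zero => exact ⟨0, map_zero _⟩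
    | of i y =>
      obtain ⟨a, ha, rfl⟩ := cls_surj _ y
      obtain ⟨s, hs, hs'⟩ := hx.exists_homogeneous i a ha
      refine ⟨s, ?_⟩
      rw [toGr_of_isHomogeneous x hx.mem hs]
      congr 1
      refine ((cls_eq_iff _ _ _).2 hs').symm
    | add y z hy hz =>
      obtain ⟨s, rfl⟩ := hy
      obtain ⟨t, rfl⟩ := hz
      exact ⟨s + t, map_add _ _ _⟩
  have hkers : RingHom.ker (aeval x : MvPolynomial σ k →ₐ[k] A) =
      RingHom.ker (toGr k x hx.mem) := by
    ext s
    rw [RingHom.mem_ker, RingHom.mem_ker]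
    constructor
    · intro hs
      refine DFinsupp.ext fun i => ?_
      rw [toGr_apply]
      exact (cls_eq_iff _ _ (zero_mem _)).2 (by simp [hker s hs i])
    · intro hs
      rw [← sum_homogeneousComponent s, map_sum]
      refine Finset.sum_eq_zero fun i _ => ?_
      have h := congrArg (fun y : Gr A => y i) hs
      simp only [toGr_apply] at h
      have h' := (cls_eq_iff (maximalIdeal A) _ (zero_mem _)).1 h
      rw [sub_zero] at h'
      -- The component of degree `i` has a value of order `i + 1`, hence equal to that of some `t`
      -- without terms of degree at most `i`. The difference is a relation whose component of degree
      -- `i` is the original one, so `hker` applies.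
      obtain ⟨t, ht, ht'⟩ := hx.exists_aeval_eq hN (i + 1) h'
      have := hker (homogeneousComponent i s - t) (by simp [ht]) i
      rwa [map_sub, ht' i (Nat.lt_succ_self i), sub_zero,
        homogeneousComponent_eq_self (homogeneousComponent_isHomogeneous i s)] at this
  exact ⟨(Ideal.quotientKerAlgEquivOfSurjective hsurj).symm.trans
    ((Ideal.quotientEquivAlgOfEq k hkers).trans
      (Ideal.quotientKerAlgEquivOfSurjective hsurj'))⟩

end CanonicalGrading

/-! ### Graded pieces as finite-dimensional vector spaces. -/

section Pieces

variable {k : Type*} [Field k] {A : Type*} [CommRing A] [Algebra k A] (I : Ideal A)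

variable (k) in
/-- The projection `I ^ i → I ^ i / I ^ (i + 1)` as a `k`-linear map. -/
def pieceMk (i : ℕ) : (I ^ i).restrictScalars k →ₗ[k] Piece I i :=
  (Submodule.mkQ (Submodule.comap (I ^ i).subtype (I ^ (i + 1)))).restrictScalars k

theorem pieceMk_apply {i : ℕ} {a : A} (ha : a ∈ I ^ i) :
    pieceMk k I i ⟨a, ha⟩ = cls I i a ha := rfl

theorem cls_eq_zero_iff {i : ℕ} {a : A} (ha : a ∈ I ^ i) :
    cls I i a ha = 0 ↔ a ∈ I ^ (i + 1) := by
  have := cls_eq_iff I ha (zero_mem (I ^ i))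
  rwa [sub_zero] at this

/-- The `k`-linear map on `I ^ i / I ^ (i + 1)` induced by a map which vanishes on
`I ^ (i + 1)`. -/
def pieceLift {W : Type*} [AddCommGroup W] [Module k W] (i : ℕ) (f : A →ₗ[k] W)
    (hf : ∀ a ∈ I ^ (i + 1), f a = 0) : Piece I i →ₗ[k] W :=
  (Submodule.liftQ ((Submodule.comap (I ^ i).subtype (I ^ (i + 1))).restrictScalars k)
    (f.comp ((I ^ i).subtype.restrictScalars k)) (fun a ha => hf a ha)).comp
  (Submodule.Quotient.restrictScalarsEquiv k
    (Submodule.comap (I ^ i).subtype (I ^ (i + 1)))).symm.toLinearMap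

theorem pieceLift_cls {W : Type*} [AddCommGroup W] [Module k W] (i : ℕ) (f : A →ₗ[k] W)
    (hf : ∀ a ∈ I ^ (i + 1), f a = 0) {a : A} (ha : a ∈ I ^ i) :
    pieceLift I i f hf (cls I i a ha) = f a := rfl

theorem finite_piece [IsNoetherianRing A] (hres : ∀ a : A, ∃ c : k, a - algebraMap k A c ∈ I)
    (i : ℕ) : Module.Finite k (Piece I i) := by
  -- `A` acts on a piece through its residue in `k`, so generators over `A` also generate over `k`.
  have hsmul : ∀ (a : A) (c : k), a - algebraMap k A c ∈ I → ∀ y : Piece I i, a • y = c • y := by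
    intro a c h y
    obtain ⟨b, hb, rfl⟩ := cls_surj I y
    have h₁ : a • b ∈ I ^ i := Ideal.mul_mem_left _ _ hb
    refine (cls_eq_iff I h₁ (smul_mem_ideal c hb)).2 ?_
    rw [smul_eq_mul, Algebra.smul_def, ← sub_mul, pow_succ']
    exact Ideal.mul_mem_mul h hb
  obtain ⟨t, ht⟩ := (inferInstance : Module.Finite A (Piece I i)).fg_top
  refine ⟨⟨t, eq_top_iff.2 fun y _ => ?_⟩⟩
  have hy : y ∈ Submodule.span A (t : Set (Piece I i)) := ht ▸ Submodule.mem_top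
  induction hy using Submodule.span_induction with
  | mem y hy => exact Submodule.subset_span hy
  | zero => exact zero_mem _
  | add y z _ _ hy hz => exact add_mem (hy trivial) (hz trivial)
  | smul a y _ hy =>
    obtain ⟨c, hc⟩ := hres a
    rw [hsmul a c hc]
    exact Submodule.smul_mem _ _ (hy trivial)

end Pieces

/-! ### Existence of coordinates and of a nondegenerate functional. -/

section Existence

variable {k : Type*} [Field k] {A : Type*} [CommRing A] [IsLocalRing A] [Algebra k A]

theorem exists_sub_algebraMap_mem
    (hres : Function.Bijective (algebraMap k (ResidueField A))) (a : A) :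
    ∃ c : k, a - algebraMap k A c ∈ maximalIdeal A := by
  obtain ⟨c, hc⟩ := hres.2 (residue A a)
  refine ⟨c, ?_⟩
  rw [← residue_eq_zero_iff, map_sub, ← hc, sub_eq_zero]
  rfl

theorem exists_isCoordinates [IsNoetherianRing A]
    (hres : ∀ a : A, ∃ c : k, a - algebraMap k A c ∈ maximalIdeal A) :
    ∃ x : Fin (hilbertFunction k A 1) → A, IsCoordinates k x := by
  have := finite_piece (maximalIdeal A) hres 1
  let b := Module.finBasis k (Piece (maximalIdeal A) 1)
  choose x hx hb using fun i => cls_surj (maximalIdeal A) (b i)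
  refine ⟨x, hres, fun i => by simpa using hx i, fun a ha => ?_⟩
  have ha' : a ∈ maximalIdeal A ^ 1 := by simpa using ha
  let r := b.repr (cls _ 1 a ha')
  have hsum : ∑ i, r i • x i ∈ maximalIdeal A ^ 1 := sum_mem fun i _ => smul_mem_ideal _ (hx i)
  refine ⟨r, (cls_eq_iff (maximalIdeal A) ha' hsum).1 ?_⟩
  rw [← b.sum_repr (cls _ 1 a ha'), ← pieceMk_apply (k := k) _ hsum]
  have : (⟨∑ i, r i • x i, hsum⟩ : (maximalIdeal A ^ 1).restrictScalars k) =
      ∑ i, r i • ⟨x i, hx i⟩ := Subtype.ext (by simp)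
  rw [this, map_sum]
  refine Finset.sum_congr rfl fun i _ => ?_
  rw [map_smul, hb i]
  rfl

/-- Forms of degree `i` always surject onto the `i`-th piece; equality of the finite dimensions
makes this map injective. -/
theorem IsCoordinates.eq_zero_of_aeval_mem {σ : Type*} [Fintype σ] {x : σ → A}
    (hx : IsCoordinates k x) {i : ℕ}
    (hi : hilbertFunction k A i = (Fintype.card σ).multichoose i)
    {s : MvPolynomial σ k} (hs : s.IsHomogeneous i)
    (h : aeval x s ∈ maximalIdeal A ^ (i + 1)) : s = 0 := by
  let f : homogeneousSubmodule σ k i →ₗ[k] Piece (maximalIdeal A) i :=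
    (pieceMk k (maximalIdeal A) i).comp
      (((aeval x : MvPolynomial σ k →ₐ[k] A).toLinearMap.domRestrict _).codRestrict
        ((maximalIdeal A ^ i).restrictScalars k) fun s => hx.aeval_mem s.2)
  have hf : ∀ (s : MvPolynomial σ k) (hs : s.IsHomogeneous i),
      f ⟨s, hs⟩ = cls (maximalIdeal A) i (aeval x s) (hx.aeval_mem hs) := fun _ _ => rfl
  have hsurj : Function.Surjective f := by
    intro y
    obtain ⟨a, ha, rfl⟩ := cls_surj _ y
    obtain ⟨s, hs, hs'⟩ := hx.exists_homogeneous i a ha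
    exact ⟨⟨s, hs⟩, ((cls_eq_iff _ _ _).2 hs').symm⟩
  have := Module.Finite.of_surjective f hsurj
  have hinj : Function.Injective f :=
    (LinearMap.injective_iff_surjective_of_finrank_eq_finrank
      ((finrank_homogeneousSubmodule i).trans hi.symm)).2 hsurj
  have h0 : f ⟨s, hs⟩ = f 0 := by
    rw [hf, map_zero]
    exact (cls_eq_zero_iff _ _).2 h
  exact congrArg Subtype.val (hinj h0)

/-- A functional is nondegenerate if its kernel contains no nonzero ideal. -/
def IsNondegenerate (φ : A →ₗ[k] k) : Prop := ∀ c : A, (∀ a, φ (c * a) = 0) → c = 0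

/-- Any `φ` that is nonzero at some `z` in `𝔪 ^ d` works: `z` lies in the socle, every nonzero ideal
meets the socle, and simplicity of the socle puts `z` into that ideal. -/
theorem exists_isNondegenerate (hA : IsArtinGorenstein A) {d : ℕ} (hd : IsSocleDegree A d)
    (hd' : maximalIdeal A ^ (d + 1) = ⊥) : ∃ φ : A →ₗ[k] k, IsNondegenerate φ := by
  obtain ⟨z, hz, hz0⟩ := Submodule.exists_mem_ne_zero_of_ne_bot hd.1
  obtain ⟨φ, hφ⟩ := Module.Projective.exists_dual_ne_zero k hz0
  have hzs : z ∈ socle A := by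
    refine Module.mem_annihilator.2 fun y => Subtype.ext ?_
    have : z * (y : A) ∈ maximalIdeal A ^ (d + 1) := by
      rw [pow_succ]
      exact Ideal.mul_mem_mul hz y.2
    rwa [hd', Ideal.mem_bot] at this
  have := hA.2
  refine ⟨φ, fun c hc => ?_⟩
  by_contra hc0
  -- With the least such exponent written `N + 1`, some `y` in `𝔪 ^ N` gives `c * y ≠ 0`, and this
  -- product is killed by `𝔪`.
  have hex : ∃ N, ∀ y ∈ maximalIdeal A ^ N, c * y = 0 := ⟨d + 1, fun y hy => by
    rw [hd', Ideal.mem_bot] at hy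
    simp [hy]⟩
  classical
  have hN0 : Nat.find hex ≠ 0 := fun h => hc0 (by simpa using (Nat.find_spec hex) 1 (by simp [h]))
  obtain ⟨N, hN⟩ := Nat.exists_eq_succ_of_ne_zero hN0
  have hmin := Nat.find_min hex (m := N) (by omega)
  push Not at hmin
  obtain ⟨y, hy, hcy⟩ := hmin
  have hcys : c * y ∈ socle A := by
    refine Module.mem_annihilator.2 fun w => Subtype.ext ?_
    have : y * (w : A) ∈ maximalIdeal A ^ (Nat.find hex) := by
      rw [hN, pow_succ]
      exact Ideal.mul_mem_mul hy w.2
    have := Nat.find_spec hex _ this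
    rwa [← mul_assoc] at this
  have hspan := IsSimpleModule.toSpanSingleton_surjective A
    (m := (⟨c * y, hcys⟩ : socle A)) (fun h => hcy (congrArg Subtype.val h))
  obtain ⟨a, ha⟩ := hspan ⟨z, hzs⟩
  have ha' : a * (c * y) = z := congrArg Subtype.val ha
  refine hφ ?_
  rw [← ha', ← hc (y * a)]
  congr 1
  ring

end Existence

/-! ### Duality between forms and powers of the maximal ideal. -/

section Duality

variable {k : Type*} [Field k] {A : Type*} [CommRing A] [IsLocalRing A] [Algebra k A]
  {σ : Type*} [Fintype σ] {x : σ → A} {φ : A →ₗ[k] k} {d : ℕ}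

theorem eq_zero_of_mem_pow_of_lt (hd : maximalIdeal A ^ (d + 1) = ⊥) {i : ℕ} (hi : d < i) {a : A}
    (ha : a ∈ maximalIdeal A ^ i) : a = 0 := by
  have := mem_of_le (show d + 1 ≤ i from hi) ha
  rwa [hd, Ideal.mem_bot] at this

namespace IsCoordinates

theorem mul_aeval_eq_zero (hx : IsCoordinates k x)
    (hd : maximalIdeal A ^ (d + 1) = ⊥) {i j : ℕ} (hij : d < i + j) {c : A}
    (hc : c ∈ maximalIdeal A ^ i) {s : MvPolynomial σ k} (hs : s.IsHomogeneous j) :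
    c * aeval x s = 0 :=
  eq_zero_of_mem_pow_of_lt hd hij (mul_mem_pow _ hc (hx.aeval_mem hs))

theorem eq_zero_of_forall_isHomogeneous (hx : IsCoordinates k x) (hφ : IsNondegenerate φ)
    (hd : maximalIdeal A ^ (d + 1) = ⊥) {c : A}
    (h : ∀ i, ∀ s : MvPolynomial σ k, s.IsHomogeneous i → φ (c * aeval x s) = 0) : c = 0 := by
  refine hφ c fun a => ?_
  obtain ⟨s, rfl⟩ := hx.aeval_surjective hd a
  rw [← sum_homogeneousComponent s, map_sum, Finset.mul_sum, map_sum]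
  exact Finset.sum_eq_zero fun i _ => h i _ (homogeneousComponent_isHomogeneous i s)

/-- Every functional on the forms of degree `i` is represented by an element of `𝔪 ^ (d - i)`. -/
def RepresentsForms (x : σ → A) (φ : A →ₗ[k] k) (d i : ℕ) : Prop :=
  ∀ g : homogeneousSubmodule σ k i →ₗ[k] k, ∃ c ∈ maximalIdeal A ^ (d - i),
    ∀ (s : MvPolynomial σ k) (hs : s.IsHomogeneous i), φ (c * aeval x s) = g ⟨s, hs⟩

/-- This is the injectivity behind `representsForms`. Corrections from `𝔪 ^ (d - i + 1)` cancel the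
pairings of `c` with forms of lower degree, and nondegeneracy then identifies `c` with the total
correction. -/
theorem mem_pow_of_forall (hx : IsCoordinates k x)
    (hφ : IsNondegenerate φ) (hd : maximalIdeal A ^ (d + 1) = ⊥) {i : ℕ}
    (hi : i ≤ d) (hrep : ∀ j < i, RepresentsForms x φ d j) {c : A}
    (hc : c ∈ maximalIdeal A ^ (d - i))
    (h : ∀ s : MvPolynomial σ k, s.IsHomogeneous i → φ (c * aeval x s) = 0) :
    c ∈ maximalIdeal A ^ (d - i + 1) := by
  -- Descent on the degree `i - j`: an element representing a functional on forms of some degree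
  -- annihilates all forms of larger degree, so pairings already cancelled stay zero.
  have key : ∀ j ≤ i, ∃ c' ∈ maximalIdeal A ^ (d - i + 1), ∀ l, i - j ≤ l →
      ∀ s : MvPolynomial σ k, s.IsHomogeneous l → φ ((c - c') * aeval x s) = 0 := by
    intro j
    induction j with
    | zero =>
      intro _
      refine ⟨0, zero_mem _, fun l hl s hs => ?_⟩
      rw [sub_zero]
      obtain rfl | hl := hl.eq_or_lt
      · exact h s hs
      · rw [hx.mul_aeval_eq_zero hd (by omega) hc hs, map_zero]
    | succ j ih =>
      intro hj
      obtain ⟨c', hc', h'⟩ := ih (by omega)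
      let g : homogeneousSubmodule σ k (i - (j + 1)) →ₗ[k] k :=
        φ.comp ((LinearMap.mulLeft k (c - c')).comp
          ((aeval x : MvPolynomial σ k →ₐ[k] A).toLinearMap.domRestrict _))
      obtain ⟨b, hb, hb'⟩ := hrep (i - (j + 1)) (by omega) g
      refine ⟨c' + b, add_mem hc' (mem_of_le (by omega) hb), fun l hl s hs => ?_⟩
      rw [← sub_sub, sub_mul, map_sub, sub_eq_zero]
      obtain rfl | hl := hl.eq_or_lt
      · rw [hb' s hs]
        rfl
      · rw [h' l (by omega) s hs, hx.mul_aeval_eq_zero hd (by omega) hb hs, map_zero]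
  obtain ⟨c', hc', h'⟩ := key i le_rfl
  have : c - c' = 0 :=
    hx.eq_zero_of_forall_isHomogeneous hφ hd fun l s hs => h' l (by omega) s hs
  rwa [sub_eq_zero.1 this]

theorem representsForms (hx : IsCoordinates k x)
    (hφ : IsNondegenerate φ) (hd : maximalIdeal A ^ (d + 1) = ⊥) {i : ℕ}
    (hi : i ≤ d)
    (hH : ∀ j ≤ i, hilbertFunction k A (d - j) = (Fintype.card σ).multichoose j) :
    RepresentsForms x φ d i := by
  induction i using Nat.strong_induction_on with
  | _ i ih =>
  have hrep : ∀ j < i, RepresentsForms x φ d j := fun j hj =>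
    ih j hj (by omega) fun l hl => hH l (by omega)
  let f : A →ₗ[k] (homogeneousSubmodule σ k i →ₗ[k] k) :=
    ((LinearMap.mul k A).compr₂ φ).compl₂
      ((aeval x : MvPolynomial σ k →ₐ[k] A).toLinearMap.domRestrict (homogeneousSubmodule σ k i))
  have hf : ∀ (c : A) (s : MvPolynomial σ k) (hs : s.IsHomogeneous i),
      f c ⟨s, hs⟩ = φ (c * aeval x s) := fun _ _ _ => rfl
  let F := pieceLift (maximalIdeal A) (d - i) f fun c hc => LinearMap.ext fun s => by
    obtain ⟨s, hs⟩ := s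
    refine (hf c s hs).trans ?_
    rw [hx.mul_aeval_eq_zero hd (by omega) hc hs, map_zero, LinearMap.zero_apply]
  have hinj : Function.Injective F := by
    rw [injective_iff_map_eq_zero]
    intro y hy
    obtain ⟨c, hc, rfl⟩ := cls_surj _ y
    rw [pieceLift_cls] at hy
    refine (cls_eq_zero_iff _ _).2 (hx.mem_pow_of_forall hφ hd hi hrep hc fun s hs => ?_)
    rw [← hf c s hs, hy, LinearMap.zero_apply]
  have := Module.Finite.of_injective F hinj
  have hsurj : Function.Surjective F := by
    refine (LinearMap.injective_iff_surjective_of_finrank_eq_finrank ?_).1 hinj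
    refine (hH i le_rfl).trans ?_
    rw [← finrank_homogeneousSubmodule (k := k)]
    exact Subspace.dual_finrank_eq.symm
  intro g
  obtain ⟨y, hy⟩ := hsurj g
  obtain ⟨c, hc, rfl⟩ := cls_surj _ y
  refine ⟨c, hc, fun s hs => ?_⟩
  rw [← hf c s hs, ← hy, pieceLift_cls]

/-- If a nondegenerate functional vanishes on the forms of all degrees `j ≥ e` except for the
socle degree, and there are no relations modulo higher order terms in degrees below `e`, then the
algebra is canonically graded. -/
theorem isCanonicallyGraded_of_functional (hx : IsCoordinates k x) (hφ : IsNondegenerate φ)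
    (hd : maximalIdeal A ^ (d + 1) = ⊥) (e : ℕ)
    (hlow : ∀ i < e, ∀ s : MvPolynomial σ k, s.IsHomogeneous i →
      aeval x s ∈ maximalIdeal A ^ (i + 1) → s = 0)
    (hφ0 : ∀ j, e ≤ j → j < d → ∀ s : MvPolynomial σ k, s.IsHomogeneous j → φ (aeval x s) = 0) :
    IsCanonicallyGraded k A := by
  have hφ1 : ∀ j, e ≤ j → j ≠ d → ∀ s : MvPolynomial σ k, s.IsHomogeneous j →
      φ (aeval x s) = 0 := by
    intro j hj hjd s hs
    obtain h | h := hjd.lt_or_gt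
    · exact hφ0 j hj h s hs
    · rw [eq_zero_of_mem_pow_of_lt hd h (hx.aeval_mem hs), map_zero]
  refine hx.isCanonicallyGraded hd fun s hs => ?_
  -- The lowest component of a relation is minus a sum of terms of higher order, so `hlow` removes
  -- components one degree at a time.
  have hsmall : ∀ i < e, homogeneousComponent i s = 0 := by
    intro i
    induction i using Nat.strong_induction_on with
    | _ i ih =>
    intro hi
    refine hlow i hi _ (homogeneousComponent_isHomogeneous i s) ?_
    by_cases hmem : i ∈ Finset.range (s.totalDegree + 1)
    · rw [← sum_homogeneousComponent s, map_sum, ← Finset.add_sum_erase _ _ hmem] at hs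
      rw [eq_neg_of_add_eq_zero_left hs]
      refine neg_mem (sum_mem fun j hj => ?_)
      obtain h | h := Nat.lt_or_gt_of_ne (Finset.ne_of_mem_erase hj)
      · rw [ih j h (by omega), map_zero]
        exact zero_mem _
      · exact mem_of_le h (hx.aeval_mem (homogeneousComponent_isHomogeneous j s))
    · rw [homogeneousComponent_eq_zero _ _ (by simpa using hmem), map_zero]
      exact zero_mem _
  intro i
  by_cases hi : i < e
  · rw [hsmall i hi, map_zero]
  refine hx.eq_zero_of_forall_isHomogeneous hφ hd fun l t ht => ?_
  have hhom : ∀ j, (homogeneousComponent j s * t).IsHomogeneous (j + l) := fun j =>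
    (homogeneousComponent_isHomogeneous j s).mul ht
  rw [← map_mul]
  -- In `φ (s * t) = 0` only products of total degree `d` can contribute, which isolates the
  -- component of degree `d - l`.
  by_cases hil : i + l = d
  · have hsum : φ (aeval x (s * t)) = 0 := by rw [map_mul, hs, zero_mul, map_zero]
    by_cases hmem : i ∈ Finset.range (s.totalDegree + 1)
    · rw [← sum_homogeneousComponent s, Finset.sum_mul, map_sum, map_sum,
        Finset.sum_eq_single_of_mem i hmem] at hsum
      · exact hsum
      · intro j _ hj
        by_cases hje : j < e
        · rw [hsmall j hje, zero_mul, map_zero, map_zero]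
        · exact hφ1 _ (by omega) (by omega) _ (hhom j)
    · rw [homogeneousComponent_eq_zero _ _ (by simpa using hmem), zero_mul, map_zero, map_zero]
  · exact hφ1 _ (by omega) hil _ (hhom i)

/-- First order Taylor expansion of a form under a change of coordinates. -/
theorem aeval_add_sub_mem (hx : IsCoordinates k x)
    {c : σ → A} (hc : ∀ i, c i ∈ maximalIdeal A ^ 2) {i : ℕ}
    {s : MvPolynomial σ k} (hs : s.IsHomogeneous i) :
    aeval (fun j => x j + c j) s - aeval x s - ∑ j, c j * aeval x (pderiv j s) ∈
      maximalIdeal A ^ (i + 2) := by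
  classical
  set π := (aeval x : MvPolynomial σ k →ₐ[k] A) with hπ
  set π' := (aeval (fun j => x j + c j) : MvPolynomial σ k →ₐ[k] A) with hπ'
  let D : MvPolynomial σ k → A := fun s => ∑ j, c j * π (pderiv j s)
  have hDadd : ∀ s t, D (s + t) = D s + D t := fun s t => by
    simp only [D, map_add, mul_add, Finset.sum_add_distrib]
  have hDmul : ∀ s t, D (s * t) = D s * π t + π s * D t := fun s t => by
    simp only [D, Derivation.leibniz, map_add, smul_eq_mul, map_mul, mul_add,
      Finset.sum_add_distrib, Finset.sum_mul, Finset.mul_sum]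
    rw [add_comm]
    congr 1 <;> exact Finset.sum_congr rfl fun j _ => by ring
  -- All three orders are carried along because the remainder of a product also involves values and
  -- first-order terms of the factors, notably `D s * D t`.
  suffices h : π s ∈ maximalIdeal A ^ i ∧ D s ∈ maximalIdeal A ^ (i + 1) ∧
      π' s - π s - D s ∈ maximalIdeal A ^ (i + 2) from h.2.2
  refine isHomogeneous_induction (P := fun i s => π s ∈ maximalIdeal A ^ i ∧
    D s ∈ maximalIdeal A ^ (i + 1) ∧ π' s - π s - D s ∈ maximalIdeal A ^ (i + 2))
    ?_ ?_ ?_ ?_ ?_ hs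
  · intro i
    simp [D]
  · rintro i s t ⟨h₁, h₂, h₃⟩ ⟨g₁, g₂, g₃⟩
    refine ⟨by rw [map_add]; exact add_mem h₁ g₁, by rw [hDadd]; exact add_mem h₂ g₂, ?_⟩
    have : π' (s + t) - π (s + t) - D (s + t) =
        (π' s - π s - D s) + (π' t - π t - D t) := by
      rw [map_add, map_add, hDadd]
      ring
    rw [this]
    exact add_mem h₃ g₃
  · intro r
    simp [D, hπ, hπ']
  · intro j
    have hD : D (X j) = c j := by
      simp [D, pderiv_X, Pi.single_apply, apply_ite π]
    rw [hD]
    refine ⟨by simpa [hπ] using hx.mem j, hc j, ?_⟩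
    simp [hπ, hπ']
  · rintro i j s t ⟨h₁, h₂, h₃⟩ ⟨g₁, g₂, g₃⟩
    have g₀ : π' t ∈ maximalIdeal A ^ j := by
      have : π' t = (π' t - π t - D t) + D t + π t := by ring
      rw [this]
      exact add_mem (add_mem (mem_of_le (by omega) g₃) (mem_of_le (by omega) g₂)) g₁
    refine ⟨by rw [map_mul]; exact mul_mem_pow _ h₁ g₁, ?_, ?_⟩
    · rw [hDmul]
      exact add_mem (mem_of_le (by omega) (mul_mem_pow _ h₂ g₁))
        (mem_of_le (by omega) (mul_mem_pow _ h₁ g₂))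
    · have : π' (s * t) - π (s * t) - D (s * t) =
          (π' s - π s - D s) * π' t + π s * (π' t - π t - D t) +
            (D s * D t + D s * (π' t - π t - D t)) := by
        rw [map_mul, map_mul, hDmul]
        ring
      rw [this]
      exact add_mem (add_mem (mem_of_le (by omega) (mul_mem_pow _ h₃ g₀))
        (mem_of_le (by omega) (mul_mem_pow _ h₁ g₃)))
        (add_mem (mem_of_le (by omega) (mul_mem_pow _ h₂ g₂))
          (mem_of_le (by omega) (mul_mem_pow _ h₂ g₃)))

/-- If the socle degree is `e + 1` with `e` invertible, one can change the coordinates so that a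
given functional vanishes on all forms of degree `e`. -/
theorem exists_add_forall_eq_zero (hx : IsCoordinates k x) {e : ℕ} (he : (e : k) ≠ 0)
    (hd : maximalIdeal A ^ (e + 2) = ⊥) (hrep : RepresentsForms x φ (e + 1) (e - 1)) :
    ∃ c : σ → A, (∀ i, c i ∈ maximalIdeal A ^ 2) ∧
      ∀ s : MvPolynomial σ k, s.IsHomogeneous e → φ (aeval (fun i => x i + c i) s) = 0 := by
  have he0 : e ≠ 0 := by
    rintro rfl
    simp at he
  let g : σ → homogeneousSubmodule σ k (e - 1) →ₗ[k] k := fun i =>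
    (-(e : k)⁻¹) • φ.comp ((LinearMap.mulLeft k (x i)).comp
      ((aeval x : MvPolynomial σ k →ₐ[k] A).toLinearMap.domRestrict _))
  choose c hc hcg using fun i => hrep (g i)
  -- The exponent `e + 1 - (e - 1)` equals `2` only because `e ≠ 0`; the subtraction is truncated.
  have hc2 : ∀ i, c i ∈ maximalIdeal A ^ 2 := fun i => mem_of_le (by omega) (hc i)
  refine ⟨c, hc2, fun s hs => ?_⟩
  have hT := eq_zero_of_mem_pow_of_lt hd (Nat.lt_succ_self _) (hx.aeval_add_sub_mem hc2 hs)
  rw [sub_sub, sub_eq_zero] at hT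
  rw [hT, map_add, map_sum]
  have h1 : ∀ i, φ (c i * aeval x (pderiv i s)) =
      -(e : k)⁻¹ * φ (aeval x (X i * pderiv i s)) := by
    intro i
    rw [hcg i _ hs.pderiv, map_mul, aeval_X]
    rfl
  simp_rw [h1]
  rw [← Finset.mul_sum, ← map_sum, ← map_sum, hs.sum_X_mul_pderiv, map_nsmul, map_nsmul,
    nsmul_eq_mul]
  field_simp
  ring

end IsCoordinates

end Duality

/-! ### Hilbert functions and the compressed case. -/

section Main

variable {k : Type*} [Field k] {A : Type*} [CommRing A] [IsLocalRing A] [Algebra k A]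

theorem IsSocleDegree.pow_succ_eq_bot {d : ℕ} (hd : IsSocleDegree A d) :
    maximalIdeal A ^ (d + 1) = ⊥ := by
  by_contra h
  exact absurd (hd.2 h) (by omega)

theorem pow_eq_bot_of_hilbertFunction_eq_zero [IsNoetherianRing A]
    (hres : ∀ a : A, ∃ c : k, a - algebraMap k A c ∈ maximalIdeal A) {i : ℕ}
    (h : hilbertFunction k A i = 0) : maximalIdeal A ^ i = ⊥ := by
  -- Finiteness is needed since `finrank` is also `0` on infinite-dimensional spaces. The conclusion
  -- is then Nakayama's lemma.
  have := finite_piece (maximalIdeal A) hres i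
  have hsub : Subsingleton (Piece (maximalIdeal A) i) := Module.finrank_zero_iff.1 h
  refine Submodule.eq_bot_of_le_smul_of_le_jacobson_bot (maximalIdeal A) _
    (IsNoetherian.noetherian _) (fun a ha => ?_) (maximalIdeal_le_jacobson _)
  rw [smul_eq_mul, ← pow_succ']
  exact (cls_eq_zero_iff (maximalIdeal A) ha).1 (Subsingleton.elim _ _)

theorem pow_ne_bot_of_hilbertFunction_ne_zero {i : ℕ}
    (h : hilbertFunction k A i ≠ 0) : maximalIdeal A ^ i ≠ ⊥ := by
  intro h0
  refine h ?_
  have : Subsingleton (Piece (maximalIdeal A) i) := by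
    refine subsingleton_of_forall_eq 0 fun y => ?_
    obtain ⟨a, ha, rfl⟩ := cls_surj _ y
    refine (cls_eq_zero_iff _ ha).2 ?_
    rw [h0, Ideal.mem_bot] at ha
    simp [ha]
  exact Module.finrank_zero_of_subsingleton

theorem isSocleDegree_of_hilbertFunction [IsNoetherianRing A]
    (hres : ∀ a : A, ∃ c : k, a - algebraMap k A c ∈ maximalIdeal A) {d : ℕ}
    (h : hilbertFunction k A d ≠ 0) (h' : hilbertFunction k A (d + 1) = 0) :
    IsSocleDegree A d := by
  refine ⟨pow_ne_bot_of_hilbertFunction_ne_zero h, fun i hi => ?_⟩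
  by_contra hlt
  refine hi (le_bot_iff.1 ?_)
  rw [← pow_eq_bot_of_hilbertFunction_eq_zero hres h']
  exact Ideal.pow_le_pow_right (by omega)

theorem hilbertFunction_one_ne_zero [IsNoetherianRing A]
    (hres : ∀ a : A, ∃ c : k, a - algebraMap k A c ∈ maximalIdeal A) {d : ℕ}
    (hd : maximalIdeal A ^ d ≠ ⊥) (hd0 : d ≠ 0) : hilbertFunction k A 1 ≠ 0 := by
  intro h
  have := pow_eq_bot_of_hilbertFunction_eq_zero hres h
  refine hd (le_bot_iff.1 ?_)
  rw [← this]
  exact Ideal.pow_le_pow_right (by omega)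

theorem IsCoordinates.eq_zero_of_aeval_mem_of_degree_zero {σ : Type*} {x : σ → A}
    {s : MvPolynomial σ k} (hs : s.IsHomogeneous 0)
    (h : aeval x s ∈ maximalIdeal A ^ 1) : s = 0 := by
  rw [← totalDegree_zero_iff_isHomogeneous, totalDegree_eq_zero_iff_eq_C] at hs
  rw [hs, algHom_C, pow_one] at h
  rw [hs]
  by_contra hne
  have hu : IsUnit (algebraMap k A (coeff 0 s)) :=
    (IsUnit.mk0 _ fun h0 => hne (by rw [h0, map_zero])).map _
  exact (mem_maximalIdeal _).1 h hu

/-- A Gorenstein local algebra of socle degree at most one is canonically graded. -/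
theorem isCanonicallyGraded_of_socleDegree_le_one
    (hres : ∀ a : A, ∃ c : k, a - algebraMap k A c ∈ maximalIdeal A)
    (hA : IsArtinGorenstein A) {d : ℕ} (hd : IsSocleDegree A d) (hd1 : d ≤ 1) :
    IsCanonicallyGraded k A := by
  have := hA.1
  obtain ⟨x, hx⟩ := exists_isCoordinates hres
  obtain ⟨φ, hφ⟩ := exists_isNondegenerate (k := k) hA hd hd.pow_succ_eq_bot
  -- With `e = d` no degree satisfies `e ≤ j < d`, so no change of coordinates is required.
  refine hx.isCanonicallyGraded_of_functional hφ hd.pow_succ_eq_bot d ?_ (by omega)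
  intro i hi s hs h
  obtain rfl : i = 0 := by omega
  exact IsCoordinates.eq_zero_of_aeval_mem_of_degree_zero hs h

/-- A Gorenstein local algebra of socle degree `e + 1`, with `e` invertible, whose Hilbert function
agrees with that of a polynomial ring in degrees below `e`, and dually from degree `2` on, is
canonically graded. -/
theorem isCanonicallyGraded_of_hilbertFunction
    (hres : ∀ a : A, ∃ c : k, a - algebraMap k A c ∈ maximalIdeal A)
    (hA : IsArtinGorenstein A) {e n : ℕ} (he : (e : k) ≠ 0) (hd : IsSocleDegree A (e + 1))
    (hn : hilbertFunction k A 1 = n)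
    (hlow : ∀ i < e, i ≠ 0 → hilbertFunction k A i = n.multichoose i)
    (hhigh : ∀ i < e, hilbertFunction k A (e + 1 - i) = n.multichoose i) :
    IsCanonicallyGraded k A := by
  subst hn
  have := hA.1
  have hbot := hd.pow_succ_eq_bot
  have he0 : e ≠ 0 := by
    rintro rfl
    simp at he
  obtain ⟨x, hx⟩ := exists_isCoordinates hres
  obtain ⟨φ, hφ⟩ := exists_isNondegenerate (k := k) hA hd hbot
  obtain ⟨c, hc, hc0⟩ := hx.exists_add_forall_eq_zero he hbot
    (hx.representsForms hφ hbot (i := e - 1) (by omega) fun j hj => by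
      rw [Fintype.card_fin]
      exact hhigh j (by omega))
  refine (hx.add hc).isCanonicallyGraded_of_functional hφ hbot e ?_ ?_
  · intro i hi s hs h
    obtain rfl | hi0 := eq_or_ne i 0
    · exact IsCoordinates.eq_zero_of_aeval_mem_of_degree_zero hs h
    · refine (hx.add hc).eq_zero_of_aeval_mem ?_ hs h
      rw [Fintype.card_fin]
      exact hlow i hi hi0
  · intro j hj hjd s hs
    obtain rfl : j = e := by omega
    exact hc0 s hs

theorem le_multichoose {n : ℕ} (hn : n ≠ 0) {i : ℕ} (hi : i ≠ 0) : n ≤ n.multichoose i := by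
  obtain ⟨n, rfl⟩ := Nat.exists_eq_succ_of_ne_zero hn
  obtain ⟨i, rfl⟩ := Nat.exists_eq_succ_of_ne_zero hi
  induction i with
  | zero => simp
  | succ i ih =>
    rw [Nat.multichoose_succ_succ]
    exact (ih (by omega)).trans (Nat.le_add_left _ _)

theorem one_le_multichoose {n : ℕ} (hn : n ≠ 0) (i : ℕ) : 1 ≤ n.multichoose i := by
  obtain rfl | hi := eq_or_ne i 0
  · simp
  · exact (Nat.one_le_iff_ne_zero.2 hn).trans (le_multichoose hn hi)

theorem IsCompressed.isCanonicallyGraded (hk2 : (2 : k) ≠ 0) (hk3 : (3 : k) ≠ 0)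
    (hres : ∀ a : A, ∃ c : k, a - algebraMap k A c ∈ maximalIdeal A)
    (hA : IsArtinGorenstein A) {d : ℕ} (hd4 : d ≤ 4) (h : IsCompressed k A d) :
    IsCanonicallyGraded k A := by
  have := hA.1
  obtain ⟨hd, hH⟩ := h
  by_cases hd1 : d ≤ 1
  · exact isCanonicallyGraded_of_socleDegree_le_one hres hA hd hd1
  have hn : hilbertFunction k A 1 ≠ 0 := hilbertFunction_one_ne_zero hres hd.1 (by omega)
  obtain ⟨e, rfl⟩ : ∃ e, d = e + 1 := ⟨d - 1, by omega⟩
  obtain ⟨n, hn'⟩ : ∃ n, hilbertFunction k A 1 = n := ⟨_, rfl⟩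
  simp only [hn'] at hH hn
  have m0 : n.multichoose 0 = 1 := Nat.multichoose_zero_right n
  have m1 : n.multichoose 1 = n := Nat.multichoose_one_right n
  have o2 := one_le_multichoose hn 2
  have o3 := one_le_multichoose hn 3
  have o4 := one_le_multichoose hn 4
  have l2 := le_multichoose hn (i := 2) (by omega)
  have l3 := le_multichoose hn (i := 3) (by omega)
  -- The bounds above decide each minimum in favour of the smaller degree; in degree `2` of the case
  -- `d = 4` both entries coincide.
  have he : e = 1 ∨ e = 2 ∨ e = 3 := by omega
  obtain rfl | rfl | rfl := he
  · refine isCanonicallyGraded_of_hilbertFunction hres hA (by simp) hd hn' (by omega) ?_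
    intro i hi
    obtain rfl : i = 0 := by omega
    have := hH 2 le_rfl
    simp only [Nat.sub_zero, Nat.reduceAdd, Nat.sub_self] at this ⊢
    rw [this]
    omega
  · refine isCanonicallyGraded_of_hilbertFunction hres hA (by simpa using hk2) hd hn' ?_ ?_
    · intro i hi hi0
      obtain rfl : i = 1 := by omega
      rw [hn', m1]
    · intro i hi
      rw [hH _ (by omega)]
      interval_cases i
      · simp only [Nat.sub_zero, Nat.reduceAdd, Nat.sub_self]
        omega
      · simp only [Nat.reduceAdd, Nat.reduceSub]
        omega
  · refine isCanonicallyGraded_of_hilbertFunction hres hA (by simpa using hk3) hd hn' ?_ ?_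
    · intro i hi hi0
      rw [hH _ (by omega)]
      obtain rfl | rfl : i = 1 ∨ i = 2 := by omega
      · simp only [Nat.reduceAdd, Nat.reduceSub]
        omega
      · simp
    · intro i hi
      rw [hH _ (by omega)]
      interval_cases i
      · simp only [Nat.sub_zero, Nat.reduceAdd, Nat.sub_self]
        omega
      · simp only [Nat.reduceAdd, Nat.reduceSub]
        omega
      · simp

theorem isCompressed_three [IsNoetherianRing A]
    (hres : ∀ a : A, ∃ c : k, a - algebraMap k A c ∈ maximalIdeal A) {n : ℕ}
    (hH : ∀ i, hilbertFunction k A i = [1, n, n, 1].getD i 0) : IsCompressed k A 3 := by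
  -- The default value `0` of `getD` gives `H_A 4 = 0`, which fixes the socle degree.
  have hd : IsSocleDegree A 3 :=
    isSocleDegree_of_hilbertFunction hres (by rw [hH]; simp) (by rw [hH]; simp)
  have h1 : hilbertFunction k A 1 = n := by rw [hH]; simp
  have hn : n ≠ 0 := h1 ▸ hilbertFunction_one_ne_zero hres hd.1 (by omega)
  refine ⟨hd, fun i hi => ?_⟩
  have o3 := one_le_multichoose hn 3
  have l2 := le_multichoose hn (i := 2) (by omega)
  rw [h1, hH]
  interval_cases i <;> simp <;> omega

theorem isCompressed_four [IsNoetherianRing A]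
    (hres : ∀ a : A, ∃ c : k, a - algebraMap k A c ∈ maximalIdeal A) {n : ℕ}
    (hH : ∀ i, hilbertFunction k A i = [1, n, (n + 1).choose 2, n, 1].getD i 0) :
    IsCompressed k A 4 := by
  have hd : IsSocleDegree A 4 :=
    isSocleDegree_of_hilbertFunction hres (by rw [hH]; simp) (by rw [hH]; simp)
  have h1 : hilbertFunction k A 1 = n := by rw [hH]; simp
  have hn : n ≠ 0 := h1 ▸ hilbertFunction_one_ne_zero hres hd.1 (by omega)
  refine ⟨hd, fun i hi => ?_⟩
  have o4 := one_le_multichoose hn 4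
  have l3 := le_multichoose hn (i := 3) (by omega)
  rw [h1, hH]
  interval_cases i
  · simp; omega
  · simp; omega
  · simp [Nat.multichoose_eq]
  · simp; omega
  · simp; omega

end Main

end AssocGr

end

theorem mainTheorem1 {k : Type*} [Field k] (hk2 : ringChar k ≠ 2) (hk3 : ringChar k ≠ 3)
    {A : Type*} [CommRing A] [IsLocalRing A] [Algebra k A]
    (hres : Function.Bijective (algebraMap k (IsLocalRing.ResidueField A)))
    (hA : AssocGr.IsArtinGorenstein A) :
    (∀ d : ℕ, d ≤ 4 → AssocGr.IsCompressed k A d → AssocGr.IsCanonicallyGraded k A) ∧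
    (∀ n : ℕ, (∀ i, AssocGr.hilbertFunction k A i = [1, n, n, 1].getD i 0) →
      AssocGr.IsCompressed k A 3 ∧ AssocGr.IsCanonicallyGraded k A) ∧
    (∀ n : ℕ, (∀ i, AssocGr.hilbertFunction k A i = [1, n, (n + 1).choose 2, n, 1].getD i 0) →
      AssocGr.IsCompressed k A 4 ∧ AssocGr.IsCanonicallyGraded k A) := by
  have := hA.1
  have hres' := AssocGr.exists_sub_algebraMap_mem hres
  have h2 : (2 : k) ≠ 0 := Ring.two_ne_zero hk2
  have h3 : (3 : k) ≠ 0 := by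
    intro h
    have hdvd : ringChar k ∣ 3 := ringChar.dvd (by exact_mod_cast h)
    obtain h1 | h3 := (Nat.dvd_prime Nat.prime_three).1 hdvd
    · exact CharP.ringChar_ne_one h1
    · exact hk3 h3
  have key : ∀ d : ℕ, d ≤ 4 → AssocGr.IsCompressed k A d → AssocGr.IsCanonicallyGraded k A :=
    fun d hd h => h.isCanonicallyGraded h2 h3 hres' hA hd
  refine ⟨key, fun n hn => ?_, fun n hn => ?_⟩
  · have hc := AssocGr.isCompressed_three hres' hn
    exact ⟨hc, key 3 (by omega) hc⟩
  · have hc := AssocGr.isCompressed_four hres' hn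
    exact ⟨hc, key 4 le_rfl hc⟩
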